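/- Let $m,n\ge 0$ be integers and let $v_1,\dots,v_m,w_1,\dots,w_m\in\mathbb{R}^n$. For $j=1,\dots,m$ let $B_j:\mathbb{R}^{2n}=\mathbb{R}^n\times\mathbb{R}^n\to\mathbb{R}^2$ be the linear map $B_j(x,y)=(\langle v_j,x\rangle,\langle w_j,y\rangle)$. For a family $\mathbf B=(B_j)_{j\in J}$ of linear maps $B_j:\mathbb{R}^N\to\mathbb{R}^{n_j}$, with $J$ finite, the Brascamp--Lieb (BL) polytope $P_{\mathbf B}$ is the set of $\mathbf p\in\mathbb{R}^J$ with $p_j\ge 0$ for all $j$, $\sum_{j} p_j n_j=N$, and $\dim U\le\sum_{j} p_j\dim(B_jU)$ for every linear subspace $U\subseteq\mathbb{R}^N$. Then the BL polytope of the datum $\mathbf B=(B_1,\dots,B_m)$ above (with $N=2n$ and all $n_j=2$) is the linear matroid intersection polytope of $(v_j)$ and $(w_j)$: $$P_{\mathbf B}=\operatorname{conv}\left\{1_I : I\subseteq\{1,\dots,m\},\ (v_i)_{i\in I}\text{ and }(w_i)_{i\in I}\text{ are both bases of }\mathbb{R}^n\right\},$$ where $1_I\in\{0,1\}^m$ is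 the characteristic vector of $I$ (and the convex hull of the empty set is empty). In particular, bipartite perfect matching polytopes are BL polytopes: for every finite simple bipartite graph $G$ with edge set $E$, there are an $n\ge 0$ and vectors $v_e,w_e\in\mathbb{R}^n$ $(e\in E)$ such that the BL polytope of the datum $B_e(x,y)=(\langle v_e,x\rangle,\langle w_e,y\rangle)$, $e\in E$, on $\mathbb{R}^{2n}$ equals the convex hull in $\mathbb{R}^E$ of the characteristic vectors of the perfect matchings of $G$. -/

import Mathlib

/-- The Brascamp-Lieb polytope of a family of linear maps `B j : E → F j` between
finite-dimensional real vector spaces: the exponent vectors `p ≥ 0` such that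
`dim E = ∑ p_j dim F_j` and `dim U ≤ ∑ p_j dim (B_j U)` for every subspace `U` of `E`. -/
def blPolytope {ι E : Type*} [Fintype ι] [AddCommGroup E] [Module ℝ E]
    {F : ι → Type*} [∀ j, AddCommGroup (F j)] [∀ j, Module ℝ (F j)]
    (B : ∀ j, E →ₗ[ℝ] F j) : Set (ι → ℝ) :=
  {p | (∀ j, 0 ≤ p j) ∧
    (Module.finrank ℝ E : ℝ) = ∑ j, p j * (Module.finrank ℝ (F j) : ℝ) ∧
    ∀ U : Submodule ℝ E,
      (Module.finrank ℝ U : ℝ) ≤ ∑ j, p j * (Module.finrank ℝ (U.map (B j)) : ℝ)}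

/-- The datum `B_j(x, y) = (⟨v_j, x⟩, ⟨w_j, y⟩)` on `ℝⁿ × ℝⁿ = ℝ²ⁿ`, with values in `ℝ²`. -/
noncomputable def pairDatum {ι : Type*} {n : ℕ} (v w : ι → EuclideanSpace ℝ (Fin n)) (j : ι) :
    EuclideanSpace ℝ (Fin n) × EuclideanSpace ℝ (Fin n) →ₗ[ℝ] ℝ × ℝ where
  toFun z := (inner ℝ (v j) z.1, inner ℝ (w j) z.2)
  map_add' z z' := by simp [inner_add_right]
  map_smul' c z := by simp [inner_smul_right]

/-- The subfamily of `u` indexed by `I` is a basis of `ℝⁿ`. -/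
def FormsBasis {ι : Type*} {n : ℕ} (u : ι → EuclideanSpace ℝ (Fin n)) (I : Set ι) : Prop :=
  LinearIndependent ℝ (fun i : I => u i) ∧ Submodule.span ℝ (u '' I) = ⊤

/-- The convex hull of the characteristic vectors of the index sets `I` for which the subfamilies
of `v` and of `w` indexed by `I` are both bases of `ℝⁿ`. -/
def matroidIntersectionPolytope {ι : Type*} {n : ℕ} (v w : ι → EuclideanSpace ℝ (Fin n)) :
    Set (ι → ℝ) :=
  convexHull ℝ {x | ∃ I : Set ι, FormsBasis v I ∧ FormsBasis w I ∧ x = I.indicator 1}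

/-- The convex hull, in `ℝᴱ` with `E` the edge set of `G`, of the characteristic vectors of the
perfect matchings of `G`. -/
def perfectMatchingPolytope {V : Type*} (G : SimpleGraph V) : Set (G.edgeSet → ℝ) :=
  convexHull ℝ {x | ∃ M : G.Subgraph, M.IsPerfectMatching ∧
    x = {e : G.edgeSet | (e : Sym2 V) ∈ M.edgeSet}.indicator 1}

/-!
The Brascamp-Lieb polytope of `B_j(x, y) = (⟨v_j, x⟩, ⟨w_j, y⟩)` is cut out by the rank functions of
the two linear matroids. On the subspace `span(v_S)ᗮ × 0` the maps `B_j`, `j ∈ S`, vanish and the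
others have rank at most one, which gives `p(S) ≤ rank v_S`; likewise for `w`. Conversely, any
subspace `U` of the product splits, for dimension counts, into its projection to the first factor and
its intersection with the second, and `dim B_j U` is at least the sum of the two contributions. So
the polytope is the intersection of the two matroid base polytopes
(`blPolytope_pairDatum_eq_commonBasePolytope`).

That this intersection has only integral vertices is Edmonds' theorem, proved here for submodular
integer-valued set functions (`exists_int_of_mem_extremePoints_commonBasePolytope`). The tight sets
of either function form a lattice, and each class of indices that they do not separate is a
difference of two nested tight sets, so it has integral mass. Hence a class containing one fractional
coordinate contains at least two, and the two families of classes together number at most as many as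
the fractional coordinates. The class sums on the two sides have the same total, so a dimension count
gives a nonzero vector, supported on the fractional coordinates, with zero sum on all classes, hence
on all tight sets (`exists_perturbation`). Moving in both of its directions shows that the point is
not extreme. Coordinates are at most one because single vectors have rank at most one, so vertices
are characteristic vectors of common bases, and the Krein-Milman theorem concludes
(`commonBasePolytope_vectorRank_eq`).

For a bipartite graph with a perfect matching, attach to each edge the standard basis vectors of its
two ends. A set of edges is a common basis exactly when each vertex is covered once
(`formsBasis_single_iff`, `isPerfectMatching_iff_bijOn`). When there is no perfect matching, zero
vectors in `ℝ¹` give the empty polytope.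
-/

/-! ### Intersections of two integral base polytopes -/

/-- The intersection of the base polytopes of two set functions `f` and `g` of total value `k`:
the vectors `p ≥ 0` of total mass `k` with `p(S) ≤ f S` and `p(S) ≤ g S` for every `S`. -/
def commonBasePolytope {ι : Type*} [Fintype ι] (f g : Finset ι → ℤ) (k : ℤ) : Set (ι → ℝ) :=
  {p | (∀ i, 0 ≤ p i) ∧ ∑ i, p i = k ∧ (∀ S : Finset ι, ∑ i ∈ S, p i ≤ f S) ∧
    ∀ S : Finset ι, ∑ i ∈ S, p i ≤ g S}

/-- The constraint `p(S) ≤ f S` holds with equality at `S`. -/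
def IsTight {ι : Type*} (f : Finset ι → ℤ) (p : ι → ℝ) (S : Finset ι) : Prop :=
  ∑ i ∈ S, p i = f S

section Tight

variable {ι : Type*} [DecidableEq ι] {f : Finset ι → ℤ} {p : ι → ℝ}

/-- Uncrossing: by submodularity, tight sets form a lattice. -/
lemma IsTight.union_and_inter (hf : ∀ S T, f (S ∪ T) + f (S ∩ T) ≤ f S + f T)
    (hp : ∀ S : Finset ι, ∑ i ∈ S, p i ≤ f S) {S T : Finset ι}
    (hS : IsTight f p S) (hT : IsTight f p T) : IsTight f p (S ∪ T) ∧ IsTight f p (S ∩ T) := by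
  have h1 := hp (S ∪ T)
  have h2 := hp (S ∩ T)
  have h3 : ∑ i ∈ S ∪ T, p i + ∑ i ∈ S ∩ T, p i = ∑ i ∈ S, p i + ∑ i ∈ T, p i :=
    Finset.sum_union_inter
  have h4 : (f (S ∪ T) : ℝ) + f (S ∩ T) ≤ f S + f T := by exact_mod_cast hf S T
  unfold IsTight at *
  constructor <;> linarith

/-- The set of all tight sets containing `i`: two indices have the same signature exactly when no
tight set separates them. -/
noncomputable def tightSignature [Fintype ι] (f : Finset ι → ℤ) (p : ι → ℝ) (i : ι) :
    Finset (Finset ι) := by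
  classical
  exact Finset.univ.filter fun S => IsTight f p S ∧ i ∈ S

lemma mem_tightSignature [Fintype ι] {i : ι} {S : Finset ι} :
    S ∈ tightSignature f p i ↔ IsTight f p S ∧ i ∈ S := by
  simp [tightSignature]

/-- A class of indices not separated by tight sets has integral mass: it is the difference of the
least tight set containing a given member and the largest tight set avoiding it. -/
lemma exists_int_sum_tightSignature_fiber [Fintype ι]
    (hf : ∀ S T, f (S ∪ T) + f (S ∩ T) ≤ f S + f T) (hf0 : f ∅ = 0)
    (hp : ∀ S : Finset ι, ∑ i ∈ S, p i ≤ f S) (hu : IsTight f p Finset.univ) (i : ι) :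
    ∃ z : ℤ, ∑ j with tightSignature f p j = tightSignature f p i, p j = z := by
  classical
  have h0 : IsTight f p ∅ := by simp [IsTight, hf0]
  set A : Finset ι := (tightSignature f p i).inf id with hA
  set M : Finset ι := (Finset.univ.filter fun S => IsTight f p S ∧ i ∉ S).sup id with hM
  have tA : IsTight f p A :=
    Finset.inf_induction (p := IsTight f p) hu
      (fun S hS T hT => (IsTight.union_and_inter hf hp hS hT).2)
      (fun S hS => (mem_tightSignature.1 hS).1)
  have tM : IsTight f p M :=
    Finset.sup_induction (p := IsTight f p) h0
      (fun S hS T hT => (IsTight.union_and_inter hf hp hS hT).1)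
      (fun S hS => (Finset.mem_filter.1 hS).2.1)
  have mA : ∀ j, j ∈ A ↔ ∀ S, IsTight f p S → i ∈ S → j ∈ S := fun j => by
    simp [hA, Finset.mem_inf, mem_tightSignature]
  have mM : ∀ j, j ∈ M ↔ ∃ S, IsTight f p S ∧ i ∉ S ∧ j ∈ S := fun j => by
    simp [hM, Finset.mem_sup, and_assoc]
  have hC : (Finset.univ.filter fun j => tightSignature f p j = tightSignature f p i) = A \ M := by
    ext j
    simp only [Finset.mem_filter, Finset.mem_univ, true_and, Finset.mem_sdiff, mA, mM,
      Finset.ext_iff, mem_tightSignature]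
    push Not
    constructor
    · exact fun h => ⟨fun S hS hi => ((h S).2 ⟨hS, hi⟩).2,
        fun S hS hi hj => hi ((h S).1 ⟨hS, hj⟩).2⟩
    · exact fun h S => ⟨fun hS => ⟨hS.1, by_contra fun hi => h.2 S hS.1 hi hS.2⟩,
        fun hS => ⟨hS.1, h.1 S hS.1 hS.2⟩⟩
  have tAM := (IsTight.union_and_inter hf hp tA tM).2
  refine ⟨f A - f (A ∩ M), ?_⟩
  have h := Finset.sum_inter_add_sum_sdiff A M p
  unfold IsTight at tA tAM
  rw [hC]
  push_cast
  linarith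

/-- A tight set is a union of classes, so a vector with zero sum on every class has zero sum
on it. -/
lemma IsTight.sum_eq_zero [Fintype ι] {d : ι → ℝ}
    (hd : ∀ a, ∑ j with tightSignature f p j = a, d j = 0) {S : Finset ι} (hS : IsTight f p S) :
    ∑ i ∈ S, d i = 0 := by
  classical
  rw [← Finset.sum_fiberwise_of_maps_to (g := tightSignature f p) (t := Finset.univ)
    (fun _ _ => Finset.mem_univ _)]
  refine Finset.sum_eq_zero fun a _ => ?_
  by_cases ha : S ∈ a
  · rw [← hd a]
    congr 1
    ext j
    simp only [Finset.mem_filter, Finset.mem_univ, true_and, and_iff_right_iff_imp]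
    rintro rfl
    exact (mem_tightSignature.1 ha).2
  · refine Finset.sum_eq_zero fun j hj => absurd ?_ ha
    obtain ⟨hjS, rfl⟩ := Finset.mem_filter.1 hj
    exact mem_tightSignature.2 ⟨hS, hjS⟩

end Tight

section Perturbation

variable {ι α β : Type*} [Fintype ι] [DecidableEq ι] [DecidableEq α] [DecidableEq β]

/-- If all fibers of `κ` have integral mass, a fiber containing a fractional coordinate contains
at least two of them. -/
lemma two_mul_card_image_fractional_le {p : ι → ℝ} {F : Finset ι}
    (hF : ∀ i, i ∈ F ↔ ¬ ∃ z : ℤ, p i = z) (κ : ι → α)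
    (hκ : ∀ i, ∃ z : ℤ, ∑ j with κ j = κ i, p j = z) :
    2 * (F.image κ).card ≤ F.card := by
  rw [mul_comm, ← smul_eq_mul, Finset.card_eq_sum_card_image κ F]
  refine Finset.card_nsmul_le_sum _ _ _ fun a ha => ?_
  obtain ⟨i, hi, rfl⟩ := Finset.mem_image.1 ha
  by_contra! hlt
  have hone : F.filter (fun j => κ j = κ i) = {i} := by
    have hmem : i ∈ F.filter (fun j => κ j = κ i) := by simp [hi]
    have : (F.filter (fun j => κ j = κ i)).card = 1 := by
      have := Finset.card_pos.2 ⟨i, hmem⟩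
      omega
    obtain ⟨b, hb⟩ := Finset.card_eq_one.1 this
    rw [hb] at hmem ⊢
    rw [Finset.mem_singleton.1 hmem]
  obtain ⟨z, hz⟩ := hκ i
  apply (hF i).1 hi
  have hrest : ∀ j ∈ (Finset.univ.filter fun j => κ j = κ i).erase i, p j = (⌊p j⌋ : ℝ) := by
    intro j hj
    rw [Finset.mem_erase, Finset.mem_filter] at hj
    have hjF : j ∉ F := fun h => hj.1 <| by
      have : j ∈ F.filter (fun j => κ j = κ i) := by simp [h, hj.2.2]
      rwa [hone, Finset.mem_singleton] at this
    rw [hF, not_not] at hjF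
    obtain ⟨y, hy⟩ := hjF
    rw [hy, Int.floor_intCast]
  refine ⟨z - ∑ j ∈ (Finset.univ.filter fun j => κ j = κ i).erase i, ⌊p j⌋, ?_⟩
  rw [← Finset.add_sum_erase _ p (show i ∈ Finset.univ.filter fun j => κ j = κ i by simp),
    Finset.sum_congr rfl hrest] at hz
  push_cast
  linarith

/-- The fractional coordinates, as edges between the fibers of `κ` and those of `μ`, form a bipartite
multigraph in which every occurring vertex has degree at least two. It has at most as many vertices
as edges, and the vertex sums satisfy one linear relation, so some nonzero vector on the edges has
zero sum at every vertex. -/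
lemma exists_perturbation {p : ι → ℝ} (κ : ι → α) (μ : ι → β)
    (hκ : ∀ i, ∃ z : ℤ, ∑ j with κ j = κ i, p j = z)
    (hμ : ∀ i, ∃ z : ℤ, ∑ j with μ j = μ i, p j = z)
    (hp : ∃ i, ¬ ∃ z : ℤ, p i = z) :
    ∃ d : ι → ℝ, d ≠ 0 ∧ (∀ i, (∃ z : ℤ, p i = z) → d i = 0) ∧
      (∀ a, ∑ j with κ j = a, d j = 0) ∧ ∀ b, ∑ j with μ j = b, d j = 0 := by
  classical
  set F : Finset ι := Finset.univ.filter fun i => ¬ ∃ z : ℤ, p i = z with hFdef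
  have hF : ∀ i, i ∈ F ↔ ¬ ∃ z : ℤ, p i = z := fun i => by simp [hFdef]
  have c1 := two_mul_card_image_fractional_le hF κ hκ
  have c2 := two_mul_card_image_fractional_le hF μ hμ
  obtain ⟨i₀, hi₀⟩ := hp
  rw [← hF] at hi₀
  -- The fiber sums on both sides have the same total, which saves one dimension in the target.
  let φ : (F.image κ → ℝ) × (F.image μ → ℝ) →ₗ[ℝ] ℝ :=
    (∑ a, LinearMap.proj a) ∘ₗ LinearMap.fst ℝ _ _ - (∑ b, LinearMap.proj b) ∘ₗ LinearMap.snd ℝ _ _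
  let L : (F → ℝ) →ₗ[ℝ] (F.image κ → ℝ) × (F.image μ → ℝ) :=
    (LinearMap.pi fun a : F.image κ =>
        ∑ i ∈ Finset.univ.filter fun i : F => κ i = a, LinearMap.proj i).prod
      (LinearMap.pi fun b : F.image μ =>
        ∑ i ∈ Finset.univ.filter fun i : F => μ i = b, LinearMap.proj i)
  have hL1 : ∀ x a, (L x).1 a = ∑ i ∈ Finset.univ.filter fun i : F => κ i = a, x i :=
    fun x a => by simp [L]
  have hL2 : ∀ x b, (L x).2 b = ∑ i ∈ Finset.univ.filter fun i : F => μ i = b, x i :=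
    fun x b => by simp [L]
  have hφL : ∀ x, L x ∈ LinearMap.ker φ := by
    intro x
    have e1 : ∑ a, (L x).1 a = ∑ i, x i := by
      simp only [hL1]
      rw [← Finset.sum_fiberwise (s := Finset.univ)
        (g := fun i : F => (⟨κ i, Finset.mem_image_of_mem κ i.2⟩ : F.image κ))]
      simp only [Subtype.ext_iff]
    have e2 : ∑ b, (L x).2 b = ∑ i, x i := by
      simp only [hL2]
      rw [← Finset.sum_fiberwise (s := Finset.univ)
        (g := fun i : F => (⟨μ i, Finset.mem_image_of_mem μ i.2⟩ : F.image μ))]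
      simp only [Subtype.ext_iff]
    simp only [φ, LinearMap.mem_ker, LinearMap.sub_apply, LinearMap.comp_apply,
      LinearMap.sum_apply, LinearMap.proj_apply, LinearMap.fst_apply, LinearMap.snd_apply, e1, e2,
      sub_self]
  have hφ : φ ≠ 0 := fun h => by
    have := LinearMap.congr_fun h (Pi.single ⟨κ i₀, Finset.mem_image_of_mem κ hi₀⟩ 1, 0)
    simp [φ] at this
  have hdim : Module.finrank ℝ (LinearMap.ker φ) < Module.finrank ℝ (F → ℝ) := by
    have h1 := LinearMap.finrank_range_add_finrank_ker φ
    have h2 : Module.finrank ℝ (LinearMap.range φ) = 1 := by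
      rw [LinearMap.range_eq_top.2 (LinearMap.surjective hφ)]
      simp
    simp only [Module.finrank_prod, Module.finrank_pi, Fintype.card_coe] at h1 ⊢
    omega
  obtain ⟨x, hx, hx0⟩ := (Submodule.ne_bot_iff _).1
    (LinearMap.ker_ne_bot_of_finrank_lt (f := L.codRestrict (LinearMap.ker φ) hφL) hdim)
  have hLx : L x = 0 := by simpa [LinearMap.mem_ker, Subtype.ext_iff] using hx
  have hsum : ∀ (s : ι → Prop) [DecidablePred s],
      ∑ j with s j, (if h : j ∈ F then x ⟨j, h⟩ else 0)
        = ∑ i ∈ Finset.univ.filter fun i : F => s i, x i := by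
    intro s _
    rw [Finset.sum_filter, Finset.sum_filter, ← Finset.sum_subset (Finset.subset_univ F),
      ← Finset.sum_coe_sort F]
    · simp
    · intro j _ hj
      simp [hj]
  refine ⟨fun i => if h : i ∈ F then x ⟨i, h⟩ else 0, fun h => hx0 ?_, fun i hi => ?_,
    fun a => ?_, fun b => ?_⟩
  · ext i
    simpa using congrFun h i
  · have : i ∉ F := by rwa [hF, not_not]
    simp [this]
  · rw [hsum fun j => κ j = a]
    by_cases ha : a ∈ F.image κ
    · rw [← hL1 x ⟨a, ha⟩, hLx]
      rfl
    · rw [Finset.filter_false_of_mem, Finset.sum_empty]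
      exact fun i _ h => ha (h ▸ Finset.mem_image_of_mem κ i.2)
  · rw [hsum fun j => μ j = b]
    by_cases hb : b ∈ F.image μ
    · rw [← hL2 x ⟨b, hb⟩, hLx]
      rfl
    · rw [Finset.filter_false_of_mem, Finset.sum_empty]
      exact fun i _ h => hb (h ▸ Finset.mem_image_of_mem μ i.2)

end Perturbation

section Integrality

variable {ι : Type*} [Fintype ι]

lemma convex_commonBasePolytope (f g : Finset ι → ℤ) (k : ℤ) :
    Convex ℝ (commonBasePolytope f g k) := by
  rintro x ⟨hx0, hxk, hxf, hxg⟩ y ⟨hy0, hyk, hyf, hyg⟩ a b ha hb hab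
  have hs : ∀ S : Finset ι, ∑ i ∈ S, (a • x + b • y) i
      = a * ∑ i ∈ S, x i + b * ∑ i ∈ S, y i := fun S => by
    simp [Finset.sum_add_distrib, Finset.mul_sum]
  have hc : ∀ c : ℝ, c = a * c + b * c := fun c => by rw [← add_mul, hab, one_mul]
  refine ⟨fun i => ?_, ?_, fun S => ?_, fun S => ?_⟩
  · simpa using add_nonneg (mul_nonneg ha (hx0 i)) (mul_nonneg hb (hy0 i))
  · rw [hs, hxk, hyk, ← hc]
  · rw [hs, hc (f S)]
    exact add_le_add (mul_le_mul_of_nonneg_left (hxf S) ha) (mul_le_mul_of_nonneg_left (hyf S) hb)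
  · rw [hs, hc (g S)]
    exact add_le_add (mul_le_mul_of_nonneg_left (hxg S) ha) (mul_le_mul_of_nonneg_left (hyg S) hb)

lemma isCompact_commonBasePolytope (f g : Finset ι → ℤ) (k : ℤ) :
    IsCompact (commonBasePolytope f g k) := by
  refine (isCompact_Icc (a := (0 : ι → ℝ)) (b := fun _ => (k : ℝ))).of_isClosed_subset ?_ ?_
  · simp only [commonBasePolytope, Set.ofPred_and, Set.ofPred_forall]
    refine IsClosed.inter ?_ (IsClosed.inter ?_ (IsClosed.inter ?_ ?_))
    · exact isClosed_iInter fun i => isClosed_le (by fun_prop) (by fun_prop)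
    · exact isClosed_eq (by fun_prop) (by fun_prop)
    · exact isClosed_iInter fun i => isClosed_le (by fun_prop) (by fun_prop)
    · exact isClosed_iInter fun i => isClosed_le (by fun_prop) (by fun_prop)
  · rintro p ⟨h0, hk, -, -⟩
    refine ⟨h0, fun i => ?_⟩
    rw [← hk]
    exact Finset.single_le_sum (fun j _ => h0 j) (Finset.mem_univ i)

open Filter Topology in
/-- Moving from `p` in a direction `d` that vanishes on all the tight constraints keeps a short
segment inside the polytope. -/
lemma eventually_add_smul_mem_commonBasePolytope {f g : Finset ι → ℤ} {k : ℤ} {p d : ι → ℝ}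
    (hp : p ∈ commonBasePolytope f g k) (h0 : ∀ i, p i = 0 → d i = 0) (hk : ∑ i, d i = 0)
    (hf : ∀ S, IsTight f p S → ∑ i ∈ S, d i = 0) (hg : ∀ S, IsTight g p S → ∑ i ∈ S, d i = 0) :
    ∀ᶠ t in 𝓝 (0 : ℝ), p + t • d ∈ commonBasePolytope f g k := by
  have hs : ∀ (S : Finset ι) (t : ℝ), ∑ i ∈ S, (p + t • d) i
      = ∑ i ∈ S, p i + t * ∑ i ∈ S, d i := fun S t => by
    simp [Finset.sum_add_distrib, Finset.mul_sum]
  -- The affine function `t ↦ a + t * b` stays at most `c` near `0`.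
  have key : ∀ a b c : ℝ, a ≤ c → (a = c → b = 0) → ∀ᶠ t in 𝓝 (0 : ℝ), a + t * b ≤ c := by
    intro a b c hac hb
    rcases hac.eq_or_lt with h | h
    · simp [hb h, h]
    · have hlim : Tendsto (fun t : ℝ => a + t * b) (𝓝 0) (𝓝 (a + 0 * b)) :=
        (by fun_prop : Continuous fun t : ℝ => a + t * b).tendsto 0
      rw [zero_mul, add_zero] at hlim
      exact (hlim.eventually_lt_const h).mono fun _ => le_of_lt
  obtain ⟨hp0, hpk, hpf, hpg⟩ := hp
  have e0 := eventually_all.2 fun i => key (-p i) (-d i) 0 (by simpa using hp0 i)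
    (fun h => by simpa using h0 i (by simpa using h))
  have e1 := eventually_all.2 fun S => key _ _ _ (hpf S) (hf S)
  have e2 := eventually_all.2 fun S => key _ _ _ (hpg S) (hg S)
  filter_upwards [e0, e1, e2] with t t0 t1 t2
  refine ⟨fun i => ?_, ?_, fun S => ?_, fun S => ?_⟩
  · have := t0 i
    simp only [Pi.add_apply, Pi.smul_apply, smul_eq_mul]
    linarith
  · rw [hs, hk, hpk, mul_zero, add_zero]
  · rw [hs]
    exact t1 S
  · rw [hs]
    exact t2 S

/-- The intersection of two integral base polytopes has integral vertices: a vertex with a fractional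
coordinate would be the midpoint of a segment in a direction that preserves all tight constraints. -/
theorem exists_int_of_mem_extremePoints_commonBasePolytope [DecidableEq ι]
    {f g : Finset ι → ℤ} {k : ℤ}
    (hf : ∀ S T, f (S ∪ T) + f (S ∩ T) ≤ f S + f T) (hf0 : f ∅ = 0) (hfk : f Finset.univ = k)
    (hg : ∀ S T, g (S ∪ T) + g (S ∩ T) ≤ g S + g T) (hg0 : g ∅ = 0) (hgk : g Finset.univ = k)
    {p : ι → ℝ} (hp : p ∈ (commonBasePolytope f g k).extremePoints ℝ) (i : ι) :
    ∃ z : ℤ, p i = z := by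
  by_contra hi
  rw [mem_extremePoints] at hp
  obtain ⟨hpP, hext⟩ := hp
  have hfu : IsTight f p Finset.univ := by rw [IsTight, hpP.2.1, hfk]
  have hgu : IsTight g p Finset.univ := by rw [IsTight, hpP.2.1, hgk]
  obtain ⟨d, hd0, hdz, hdf, hdg⟩ := exists_perturbation (tightSignature f p) (tightSignature g p)
    (exists_int_sum_tightSignature_fiber hf hf0 hpP.2.2.1 hfu)
    (exists_int_sum_tightSignature_fiber hg hg0 hpP.2.2.2 hgu) ⟨i, hi⟩
  have hev := eventually_add_smul_mem_commonBasePolytope hpP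
    (fun i hi => hdz i ⟨0, by simpa using hi⟩) (hfu.sum_eq_zero hdf)
    (fun S hS => hS.sum_eq_zero hdf) (fun S hS => hS.sum_eq_zero hdg)
  obtain ⟨ε, hε, hball⟩ := Metric.eventually_nhds_iff.1 hev
  have h1 := hball (y := ε / 2) (by rw [Real.dist_eq, sub_zero, abs_of_pos] <;> linarith)
  have h2 := hball (y := -(ε / 2))
    (by rw [Real.dist_eq, sub_zero, abs_neg, abs_of_pos] <;> linarith)
  have h3 := (hext _ h1 _ h2 ⟨1 / 2, 1 / 2, by norm_num, by norm_num, by norm_num, by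
    ext j
    simp
    ring⟩).1
  exact hd0 ((smul_eq_zero.1 (add_eq_left.1 h3)).resolve_left (by positivity))

end Integrality

/-! ### The rank function of a family of vectors -/

section Rank

variable {ι : Type*} {n : ℕ}

/-- The rank function of the linear matroid represented by the family `u`. -/
noncomputable def vectorRank (u : ι → EuclideanSpace ℝ (Fin n)) (S : Finset ι) : ℕ :=
  Module.finrank ℝ (Submodule.span ℝ (u '' S))

lemma vectorRank_empty (u : ι → EuclideanSpace ℝ (Fin n)) : vectorRank u ∅ = 0 := by
  simp [vectorRank]

lemma vectorRank_singleton_le (u : ι → EuclideanSpace ℝ (Fin n)) (i : ι) :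
    vectorRank u {i} ≤ 1 := by
  rw [vectorRank, Finset.coe_singleton, Set.image_singleton]
  simpa using finrank_span_le_card (R := ℝ) ({u i} : Set (EuclideanSpace ℝ (Fin n)))

lemma vectorRank_le (u : ι → EuclideanSpace ℝ (Fin n)) (S : Finset ι) : vectorRank u S ≤ n := by
  simpa [vectorRank] using (Submodule.span ℝ (u '' S)).finrank_le

lemma vectorRank_union_add_inter_le [DecidableEq ι] (u : ι → EuclideanSpace ℝ (Fin n))
    (S T : Finset ι) :
    vectorRank u (S ∪ T) + vectorRank u (S ∩ T) ≤ vectorRank u S + vectorRank u T := by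
  unfold vectorRank
  rw [← Submodule.finrank_sup_add_finrank_inf_eq (Submodule.span ℝ (u '' S)), Finset.coe_union,
    Set.image_union, Submodule.span_union]
  have hle : Submodule.span ℝ (u '' ↑(S ∩ T))
      ≤ Submodule.span ℝ (u '' S) ⊓ Submodule.span ℝ (u '' T) :=
    le_inf (Submodule.span_mono (Set.image_mono (by simp)))
      (Submodule.span_mono (Set.image_mono (by simp)))
  exact Nat.add_le_add_left (Submodule.finrank_mono hle) _

lemma formsBasis_of_card_le_vectorRank {u : ι → EuclideanSpace ℝ (Fin n)} {S : Finset ι}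
    (hS : S.card = n) (hr : S.card ≤ vectorRank u S) : FormsBasis u (S : Set ι) := by
  have hli : LinearIndependent ℝ (fun i : (S : Set ι) => u i) := by
    rw [linearIndependent_iff_card_le_finrank_span]
    rw [Set.finrank, ← Set.image_eq_range]
    simpa [vectorRank] using hr
  refine ⟨hli, Submodule.eq_top_of_finrank_eq (le_antisymm (Submodule.finrank_le _) ?_)⟩
  rw [finrank_euclideanSpace, Fintype.card_fin]
  exact hS.symm.le.trans hr

lemma FormsBasis.card_eq {u : ι → EuclideanSpace ℝ (Fin n)} {I : Finset ι}
    (h : FormsBasis u (I : Set ι)) : I.card = n := by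
  have h1 := finrank_span_eq_card h.1
  rw [← Set.image_eq_range, h.2] at h1
  simpa using h1.symm

lemma FormsBasis.card_inter_le [DecidableEq ι] {u : ι → EuclideanSpace ℝ (Fin n)} {I : Finset ι}
    (h : FormsBasis u (I : Set ι)) (S : Finset ι) : (S ∩ I).card ≤ vectorRank u S := by
  have hli : LinearIndependent ℝ (fun i : (↑(S ∩ I) : Set ι) => u i) :=
    h.1.comp (Set.inclusion (by simp)) (Set.inclusion_injective _)
  have h1 := finrank_span_eq_card hli
  rw [← Set.image_eq_range] at h1
  calc (S ∩ I).card = Module.finrank ℝ (Submodule.span ℝ (u '' ↑(S ∩ I))) :=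
      (h1.trans (Fintype.card_coe _)).symm
    _ ≤ vectorRank u S :=
      Submodule.finrank_mono (Submodule.span_mono (Set.image_mono (by simp)))

end Rank

/-! ### The Brascamp-Lieb polytope as an intersection of base polytopes -/

section BrascampLieb

/-- Rank-nullity for the first projection restricted to `X`. -/
lemma finrank_map_fst_add_finrank_comap_inr {M N : Type*} [AddCommGroup M] [Module ℝ M]
    [AddCommGroup N] [Module ℝ N] [FiniteDimensional ℝ M] [FiniteDimensional ℝ N]
    (X : Submodule ℝ (M × N)) :
    Module.finrank ℝ (X.map (LinearMap.fst ℝ M N))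
      + Module.finrank ℝ (X.comap (LinearMap.inr ℝ M N)) = Module.finrank ℝ X := by
  rw [← LinearMap.finrank_range_add_finrank_ker ((LinearMap.fst ℝ M N).domRestrict X),
    LinearMap.range_domRestrict]
  congr 1
  let e : X.comap (LinearMap.inr ℝ M N) →ₗ[ℝ] X :=
    (LinearMap.inr ℝ M N).restrict (p := X.comap (LinearMap.inr ℝ M N)) (q := X) fun _ h => h
  have he : Function.Injective e := fun a b h => by
    exact Subtype.ext (congrArg (fun z : X => z.1.2) h)
  have hr : LinearMap.range e = LinearMap.ker ((LinearMap.fst ℝ M N).domRestrict X) := by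
    ext ⟨⟨a, b⟩, hx⟩
    constructor
    · rintro ⟨y, hy⟩
      have : (0 : M) = a := congrArg (fun z : X => z.1.1) hy
      simp [this]
    · intro h
      have h0 : a = 0 := by simpa using h
      subst h0
      exact ⟨⟨b, hx⟩, rfl⟩
  rw [← hr, LinearMap.finrank_range_of_inj he]

variable {ι : Type*} {n : ℕ}

open Classical in
/-- The dimension of a subspace `U` of `ℝⁿ` is bounded by the mass of the vectors that are not
orthogonal to it, as soon as `p` lies below the rank function. -/
lemma finrank_le_sum_of_le_vectorRank [Fintype ι] {u : ι → EuclideanSpace ℝ (Fin n)} {p : ι → ℝ}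
    (hk : ∑ i, p i = n) (hr : ∀ S : Finset ι, ∑ i ∈ S, p i ≤ vectorRank u S)
    (U : Submodule ℝ (EuclideanSpace ℝ (Fin n))) :
    (Module.finrank ℝ U : ℝ) ≤ ∑ i, p i * (if u i ∈ Uᗮ then 0 else 1) := by
  have h1 := hr (Finset.univ.filter fun i => u i ∈ Uᗮ)
  have h2 : vectorRank u (Finset.univ.filter fun i => u i ∈ Uᗮ) ≤ Module.finrank ℝ Uᗮ := by
    refine Submodule.finrank_mono (Submodule.span_le.2 ?_)
    rintro _ ⟨i, hi, rfl⟩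
    simpa using hi
  have h3 : Module.finrank ℝ U + Module.finrank ℝ Uᗮ = n := by
    simpa using U.finrank_add_finrank_orthogonal
  have h4 : ∑ i, p i * (if u i ∈ Uᗮ then 0 else 1)
      = ∑ i, p i - ∑ i with u i ∈ Uᗮ, p i := by
    rw [Finset.sum_filter, ← Finset.sum_sub_distrib]
    refine Finset.sum_congr rfl fun i _ => ?_
    split_ifs <;> simp
  have h5 : (vectorRank u (Finset.univ.filter fun i => u i ∈ Uᗮ) : ℝ) ≤ Module.finrank ℝ Uᗮ := by
    exact_mod_cast h2
  have h6 : (Module.finrank ℝ U : ℝ) + Module.finrank ℝ Uᗮ = n := by exact_mod_cast h3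
  rw [h4, hk]
  linarith

open Classical in
/-- Slicing `U` along the first projection bounds `dim B_j U` below by the contributions of the
projection of `U` and of its intersection with the second factor. -/
lemma ite_add_ite_le_finrank_map_pairDatum (v w : ι → EuclideanSpace ℝ (Fin n)) (j : ι)
    (U : Submodule ℝ (EuclideanSpace ℝ (Fin n) × EuclideanSpace ℝ (Fin n))) :
    (if v j ∈ (U.map (LinearMap.fst ℝ _ _))ᗮ then 0 else 1)
      + (if w j ∈ (U.comap (LinearMap.inr ℝ _ _))ᗮ then 0 else 1)
      ≤ Module.finrank ℝ (U.map (pairDatum v w j)) := by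
  rw [← finrank_map_fst_add_finrank_comap_inr]
  refine add_le_add ?_ ?_
  · split_ifs with h
    · exact Nat.zero_le _
    · rw [Submodule.one_le_finrank_iff]
      contrapose! h
      rw [Submodule.mem_orthogonal']
      rintro _ ⟨z, hz, rfl⟩
      have : (pairDatum v w j z).1 ∈ (U.map (pairDatum v w j)).map (LinearMap.fst ℝ ℝ ℝ) :=
        ⟨_, ⟨z, hz, rfl⟩, rfl⟩
      rw [h] at this
      simpa [pairDatum] using this
  · split_ifs with h
    · exact Nat.zero_le _
    · rw [Submodule.one_le_finrank_iff]
      contrapose! h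
      rw [Submodule.mem_orthogonal']
      intro y hy
      have : (inner ℝ (w j) y : ℝ) ∈ (U.map (pairDatum v w j)).comap (LinearMap.inr ℝ ℝ ℝ) :=
        ⟨(0, y), hy, by simp [pairDatum]⟩
      rw [h] at this
      simpa using this

/-- The Brascamp-Lieb inequality for a subspace `U` of dimension `n - r` on which the `B_j` with
`j ∈ S` vanish and the others have rank at most one. -/
lemma sum_le_of_map_eq_bot [Fintype ι] {v w : ι → EuclideanSpace ℝ (Fin n)} {p : ι → ℝ} {r : ℕ}
    (hp : p ∈ blPolytope (pairDatum v w)) (hk : ∑ i, p i = n) {S : Finset ι}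
    (U : Submodule ℝ (EuclideanSpace ℝ (Fin n) × EuclideanSpace ℝ (Fin n)))
    (hU : r + Module.finrank ℝ U = n)
    (h0 : ∀ j ∈ S, U.map (pairDatum v w j) = ⊥)
    (h1 : ∀ j, Module.finrank ℝ (U.map (pairDatum v w j)) ≤ 1) :
    ∑ i ∈ S, p i ≤ r := by
  classical
  have h2 : ∑ j, p j * (Module.finrank ℝ (U.map (pairDatum v w j)) : ℝ)
      ≤ ∑ j, p j - ∑ j ∈ S, p j := by
    rw [← Finset.sum_sdiff (Finset.subset_univ S), ← Finset.sum_sdiff (Finset.subset_univ S),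
      add_sub_cancel_right, Finset.sum_eq_zero (s := S), add_zero]
    · exact Finset.sum_le_sum fun j _ =>
        mul_le_of_le_one_right (hp.1 j) (by exact_mod_cast h1 j)
    · intro j hj
      simp [h0 j hj]
  have h3 := hp.2.2 U
  have h4 : (r : ℝ) + Module.finrank ℝ U = n := by exact_mod_cast hU
  linarith

lemma vectorRank_add_finrank_orthogonal (u : ι → EuclideanSpace ℝ (Fin n)) (S : Finset ι) :
    vectorRank u S + Module.finrank ℝ (Submodule.span ℝ (u '' S))ᗮ = n := by
  rw [vectorRank, Submodule.finrank_add_finrank_orthogonal, finrank_euclideanSpace,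
    Fintype.card_fin]

lemma inner_eq_zero_of_mem_span_orthogonal {u : ι → EuclideanSpace ℝ (Fin n)} {S : Finset ι}
    {j : ι} (hj : j ∈ S) {x : EuclideanSpace ℝ (Fin n)}
    (hx : x ∈ (Submodule.span ℝ (u '' S))ᗮ) : inner ℝ (u j) x = 0 :=
  (Submodule.mem_orthogonal _ _).1 hx _ (Submodule.subset_span ⟨j, hj, rfl⟩)

/-- The subspaces `span(v_S)ᗮ × 0` and `0 × span(w_S)ᗮ` give the two rank constraints; conversely
these constraints give the inequality for the projection of `U` and for its intersection with the
second factor, whose dimensions add up to `dim U`. -/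
theorem blPolytope_pairDatum_eq_commonBasePolytope [Fintype ι]
    (v w : ι → EuclideanSpace ℝ (Fin n)) :
    blPolytope (pairDatum v w)
      = commonBasePolytope (fun S => vectorRank v S) (fun S => vectorRank w S) n := by
  classical
  ext p
  constructor
  · intro hp
    have hk : ∑ i, p i = n := by
      have := hp.2.1
      simp only [Module.finrank_prod, finrank_euclideanSpace, Fintype.card_fin,
        Module.finrank_self, ← Finset.sum_mul] at this
      push_cast at this
      linarith
    refine ⟨hp.1, by simpa using hk, fun S => ?_, fun S => ?_⟩
    · have hmap : ∀ j, ((Submodule.span ℝ (v '' S))ᗮ.map (LinearMap.inl ℝ _ _)).map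
          (pairDatum v w j) ≤ LinearMap.range (LinearMap.inl ℝ ℝ ℝ) := by
        rintro j _ ⟨_, ⟨x, hx, rfl⟩, rfl⟩
        exact ⟨inner ℝ (v j) x, by simp [pairDatum]⟩
      refine mod_cast sum_le_of_map_eq_bot hp hk
        ((Submodule.span ℝ (v '' S))ᗮ.map (LinearMap.inl ℝ _ _)) ?_ (fun j hj => ?_) (fun j => ?_)
      · rw [(Submodule.equivMapOfInjective _ LinearMap.inl_injective _).symm.finrank_eq]
        exact vectorRank_add_finrank_orthogonal v S
      · rw [Submodule.eq_bot_iff]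
        rintro _ ⟨_, ⟨x, hx, rfl⟩, rfl⟩
        simp [pairDatum, inner_eq_zero_of_mem_span_orthogonal hj hx]
      · refine (Submodule.finrank_mono (hmap j)).trans ?_
        rw [LinearMap.finrank_range_of_inj LinearMap.inl_injective, Module.finrank_self]
    · have hmap : ∀ j, ((Submodule.span ℝ (w '' S))ᗮ.map (LinearMap.inr ℝ _ _)).map
          (pairDatum v w j) ≤ LinearMap.range (LinearMap.inr ℝ ℝ ℝ) := by
        rintro j _ ⟨_, ⟨x, hx, rfl⟩, rfl⟩
        exact ⟨inner ℝ (w j) x, by simp [pairDatum]⟩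
      refine mod_cast sum_le_of_map_eq_bot hp hk
        ((Submodule.span ℝ (w '' S))ᗮ.map (LinearMap.inr ℝ _ _)) ?_ (fun j hj => ?_) (fun j => ?_)
      · rw [(Submodule.equivMapOfInjective _ LinearMap.inr_injective _).symm.finrank_eq]
        exact vectorRank_add_finrank_orthogonal w S
      · rw [Submodule.eq_bot_iff]
        rintro _ ⟨_, ⟨x, hx, rfl⟩, rfl⟩
        simp [pairDatum, inner_eq_zero_of_mem_span_orthogonal hj hx]
      · refine (Submodule.finrank_mono (hmap j)).trans ?_
        rw [LinearMap.finrank_range_of_inj LinearMap.inr_injective, Module.finrank_self]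
  · rintro ⟨h0, hk, hv, hw⟩
    replace hk : ∑ i, p i = n := by simpa using hk
    refine ⟨h0, ?_, fun U => ?_⟩
    · simp only [Module.finrank_prod, finrank_euclideanSpace, Fintype.card_fin,
        Module.finrank_self, ← Finset.sum_mul, hk]
      push_cast
      ring
    · have hv' := finrank_le_sum_of_le_vectorRank hk (fun S => by simpa using hv S)
        (U.map (LinearMap.fst ℝ _ _))
      have hw' := finrank_le_sum_of_le_vectorRank hk (fun S => by simpa using hw S)
        (U.comap (LinearMap.inr ℝ _ _))
      rw [← finrank_map_fst_add_finrank_comap_inr U]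
      push_cast
      refine (add_le_add hv' hw').trans ?_
      rw [← Finset.sum_add_distrib]
      refine Finset.sum_le_sum fun j _ => ?_
      rw [← mul_add]
      refine mul_le_mul_of_nonneg_left ?_ (h0 j)
      exact_mod_cast ite_add_ite_le_finrank_map_pairDatum v w j U

end BrascampLieb

/-! ### Matroid intersection -/

section MatroidIntersection

variable {ι : Type*} {n : ℕ}

lemma sum_indicator_one_eq_card_inter [DecidableEq ι] (I S : Finset ι) :
    ∑ i ∈ S, (I : Set ι).indicator (1 : ι → ℝ) i = (S ∩ I).card := by
  simp [Set.indicator_apply, Finset.sum_ite_mem]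

/-- Linear matroid intersection: the vertices are integral with coordinates at most `1`, hence are
characteristic vectors of common bases. -/
theorem commonBasePolytope_vectorRank_eq [Fintype ι] (v w : ι → EuclideanSpace ℝ (Fin n)) :
    commonBasePolytope (fun S => vectorRank v S) (fun S => vectorRank w S) n
      = matroidIntersectionPolytope v w := by
  classical
  set P := commonBasePolytope (fun S => (vectorRank v S : ℤ)) (fun S => vectorRank w S) n with hP
  apply subset_antisymm
  · rcases P.eq_empty_or_nonempty with hemp | ⟨p₀, hp₀⟩
    · simp [hemp]
    -- A point of `P` forces both families to span `ℝⁿ`.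
    have huniv : ∀ u : ι → EuclideanSpace ℝ (Fin n),
        (∑ i, p₀ i ≤ (vectorRank u Finset.univ : ℤ)) →
        ((vectorRank u Finset.univ : ℕ) : ℤ) = (n : ℤ) := by
      intro u hu
      rw [hp₀.2.1] at hu
      exact le_antisymm (by exact_mod_cast vectorRank_le u _) (by exact_mod_cast hu)
    have hext : P.extremePoints ℝ ⊆
        {x | ∃ I : Set ι, FormsBasis v I ∧ FormsBasis w I ∧ x = I.indicator 1} := by
      intro p hp
      obtain ⟨h0, hk, hv, hw⟩ := hp.1
      have h01 : ∀ i, p i = 0 ∨ p i = 1 := by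
        intro i
        obtain ⟨z, hz⟩ := exists_int_of_mem_extremePoints_commonBasePolytope
          (f := fun S => (vectorRank v S : ℤ)) (g := fun S => (vectorRank w S : ℤ)) (k := n)
          (fun S T => by exact_mod_cast vectorRank_union_add_inter_le v S T)
          (by simp [vectorRank_empty]) (huniv v (hp₀.2.2.1 _))
          (fun S T => by exact_mod_cast vectorRank_union_add_inter_le w S T)
          (by simp [vectorRank_empty]) (huniv w (hp₀.2.2.2 _)) hp i
        have hle : p i ≤ 1 := by
          have h1 := hv {i}
          have h2 : (vectorRank v {i} : ℝ) ≤ 1 := by exact_mod_cast vectorRank_singleton_le v i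
          simp only [Finset.sum_singleton, Int.cast_natCast] at h1
          linarith
        have hge := h0 i
        rw [hz] at hle hge ⊢
        have h1 : z ≤ 1 := by exact_mod_cast hle
        have h2 : 0 ≤ z := by exact_mod_cast hge
        have h3 : z = 0 ∨ z = 1 := by omega
        exact_mod_cast h3
      set I : Finset ι := Finset.univ.filter fun i => p i = 1 with hI
      have hpI : p = (I : Set ι).indicator 1 := by
        ext i
        rcases h01 i with h | h <;> simp [hI, h]
      have hcard : I.card = n := by
        rw [hpI, sum_indicator_one_eq_card_inter, Finset.univ_inter] at hk
        exact_mod_cast hk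
      have hvI := hv I
      have hwI := hw I
      rw [hpI, sum_indicator_one_eq_card_inter, Finset.inter_self, Int.cast_natCast,
        Nat.cast_le] at hvI hwI
      exact ⟨I, formsBasis_of_card_le_vectorRank hcard hvI,
        formsBasis_of_card_le_vectorRank hcard hwI, hpI⟩
    have hfin : {x : ι → ℝ | ∃ I : Set ι, FormsBasis v I ∧ FormsBasis w I ∧
        x = I.indicator 1}.Finite :=
      (Set.finite_range fun I : Set ι => I.indicator (1 : ι → ℝ)).subset
        fun x ⟨I, _, _, hx⟩ => ⟨I, hx.symm⟩
    rw [← closure_convexHull_extremePoints (s := P) (isCompact_commonBasePolytope _ _ _)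
      (convex_commonBasePolytope _ _ _)]
    exact closure_minimal (convexHull_mono hext) (hfin.isClosed_convexHull ℝ)
  · refine convexHull_min ?_ (convex_commonBasePolytope _ _ _)
    rintro _ ⟨I, hv, hw, rfl⟩
    lift I to Finset ι using I.toFinite
    refine ⟨fun i => Set.indicator_nonneg (by simp) i, ?_, fun S => ?_, fun S => ?_⟩
    · rw [sum_indicator_one_eq_card_inter, Finset.univ_inter, hv.card_eq]
      simp
    · rw [sum_indicator_one_eq_card_inter]
      simpa using hv.card_inter_le S
    · rw [sum_indicator_one_eq_card_inter]
      simpa using hw.card_inter_le S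

theorem blPolytope_pairDatum_eq_matroidIntersectionPolytope [Fintype ι]
    (v w : ι → EuclideanSpace ℝ (Fin n)) :
    blPolytope (pairDatum v w) = matroidIntersectionPolytope v w :=
  (blPolytope_pairDatum_eq_commonBasePolytope v w).trans (commonBasePolytope_vectorRank_eq v w)

end MatroidIntersection

/-! ### Perfect matchings of bipartite graphs -/

section PerfectMatching

/-- A subfamily of a family of standard basis vectors is a basis exactly when it runs through the
standard basis without repetition. -/
lemma formsBasis_single_iff {ι : Type*} {n : ℕ} (α : ι → Fin n) (I : Set ι) :
    FormsBasis (fun i => EuclideanSpace.single (α i) (1 : ℝ)) I ↔ Set.BijOn α I Set.univ := by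
  constructor
  · rintro ⟨hli, hspan⟩
    refine ⟨Set.mapsTo_univ _ _, fun i hi j hj hij => ?_, fun k _ => ?_⟩
    · have : (⟨i, hi⟩ : I) = ⟨j, hj⟩ := hli.injective (by simp [hij])
      exact congrArg Subtype.val this
    · by_contra hk
      have hle : Submodule.span ℝ ((fun i => EuclideanSpace.single (α i) (1 : ℝ)) '' I)
          ≤ LinearMap.ker (EuclideanSpace.proj k : EuclideanSpace ℝ (Fin n) →L[ℝ] ℝ).toLinearMap := by
        rw [Submodule.span_le]
        rintro _ ⟨i, hi, rfl⟩
        have : k ≠ α i := fun h => hk ⟨i, hi, h.symm⟩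
        simp [this]
      rw [hspan] at hle
      have := hle (Submodule.mem_top (x := EuclideanSpace.single k (1 : ℝ)))
      simp at this
  · intro h
    refine ⟨?_, ?_⟩
    · have := (EuclideanSpace.basisFun (Fin n) ℝ).toBasis.linearIndependent.comp
        (fun i : I => α i) h.injOn.injective
      simpa [Function.comp_def] using this
    · have himg : (fun i => EuclideanSpace.single (α i) (1 : ℝ)) '' I
          = Set.range (EuclideanSpace.basisFun (Fin n) ℝ).toBasis := by
        have : (fun i => EuclideanSpace.single (α i) (1 : ℝ))
            = (EuclideanSpace.basisFun (Fin n) ℝ).toBasis ∘ α := by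
          ext1 i
          simp
        rw [this, Set.image_comp, h.image_eq, Set.image_univ]
      rw [himg, Module.Basis.span_eq]

variable {V : Type*} {G : SimpleGraph V}

/-- If every edge has exactly one end in `P`, then the map to that end is a bijection on the edges
of `M` exactly when each vertex of `P` has a unique `M`-neighbor. -/
lemma bijOn_edgeSet_iff {P : V → Prop} (hP : ∀ x y, G.Adj x y → P x → ¬ P y)
    (α : G.edgeSet → {x // P x}) (β : G.edgeSet → V)
    (h : ∀ e : G.edgeSet, (e : Sym2 V) = s(↑(α e), β e)) (M : G.Subgraph) :
    Set.BijOn α {e : G.edgeSet | (e : Sym2 V) ∈ M.edgeSet} Set.univ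
      ↔ ∀ x, P x → ∃! y, M.Adj x y := by
  have hadj : ∀ e : G.edgeSet, (e : Sym2 V) ∈ M.edgeSet → M.Adj (α e) (β e) := by
    intro e he
    rwa [h e, SimpleGraph.Subgraph.mem_edgeSet] at he
  have hends : ∀ x y, P x → M.Adj x y →
      ∃ e : G.edgeSet, (e : Sym2 V) ∈ M.edgeSet ∧ (α e : V) = x ∧ β e = y := by
    intro x y hx hxy
    refine ⟨⟨s(x, y), hxy.adj_sub⟩, hxy, ?_⟩
    rcases Sym2.eq_iff.1 (h ⟨s(x, y), hxy.adj_sub⟩) with ⟨h1, h2⟩ | ⟨-, h2⟩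
    · exact ⟨h1.symm, h2.symm⟩
    · exact absurd (h2 ▸ (α ⟨s(x, y), hxy.adj_sub⟩).2) (hP x y hxy.adj_sub hx)
  constructor
  · intro hbij x hx
    obtain ⟨e, he, hex⟩ := hbij.surjOn (Set.mem_univ ⟨x, hx⟩)
    have hex' : (α e : V) = x := congrArg Subtype.val hex
    refine ⟨β e, hex' ▸ hadj e he, fun y hy => ?_⟩
    obtain ⟨e', he', h1, rfl⟩ := hends x y hx hy
    rw [hbij.injOn he' he (Subtype.ext (h1.trans hex'.symm))]
  · intro huniq
    refine ⟨Set.mapsTo_univ _ _, fun e he e' he' hee => ?_, fun x _ => ?_⟩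
    · have h1 := hadj e he
      have h2 := hadj e' he'
      rw [← hee] at h2
      have h3 := (huniq _ (α e).2).unique h1 h2
      exact Subtype.ext (by rw [h e, h e', hee, h3])
    · obtain ⟨y, hy, -⟩ := huniq x x.2
      obtain ⟨e, he, h1, -⟩ := hends x y x.2 hy
      exact ⟨e, he, Subtype.ext h1⟩

/-- A perfect matching of a bipartite graph is a set of edges that both end maps send bijectively
onto the two color classes. -/
lemma isPerfectMatching_iff_bijOn (C : G.Coloring (Fin 2)) (α : G.edgeSet → {x // C x = 0})
    (β : G.edgeSet → {x // C x = 1}) (h : ∀ e : G.edgeSet, (e : Sym2 V) = s(↑(α e), ↑(β e)))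
    (M : G.Subgraph) :
    M.IsPerfectMatching ↔
      Set.BijOn α {e : G.edgeSet | (e : Sym2 V) ∈ M.edgeSet} Set.univ ∧
      Set.BijOn β {e : G.edgeSet | (e : Sym2 V) ∈ M.edgeSet} Set.univ := by
  have hC : ∀ k : Fin 2, ∀ x y, G.Adj x y → C x = k → ¬ C y = k :=
    fun k x y hxy hx hy => C.valid hxy (hx.trans hy.symm)
  rw [bijOn_edgeSet_iff (hC 0) α (fun e => β e) h,
    bijOn_edgeSet_iff (hC 1) β (fun e => α e) (fun e => (h e).trans Sym2.eq_swap),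
    SimpleGraph.Subgraph.isPerfectMatching_iff]
  refine ⟨fun hM => ⟨fun x _ => hM x, fun x _ => hM x⟩, fun hM x => ?_⟩
  rcases (by omega : C x = 0 ∨ C x = 1) with hx | hx
  · exact hM.1 x hx
  · exact hM.2 x hx

/-- The spanning subgraph with a prescribed set of edges. -/
def edgeSubgraph (I : Set G.edgeSet) : G.Subgraph where
  verts := Set.univ
  Adj x y := ∃ h : G.Adj x y, (⟨s(x, y), h⟩ : G.edgeSet) ∈ I
  adj_sub h := h.1
  edge_vert _ := Set.mem_univ _
  symm := ⟨fun x y ⟨h, hI⟩ => ⟨h.symm, by simpa only [Sym2.eq_swap] using hI⟩⟩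

lemma setOf_mem_edgeSet_edgeSubgraph (I : Set G.edgeSet) :
    {e : G.edgeSet | (e : Sym2 V) ∈ (edgeSubgraph I).edgeSet} = I := by
  ext ⟨e, he⟩
  induction e with | _ x y
  exact ⟨fun ⟨_, h⟩ => h, fun h => ⟨he, h⟩⟩

/-- With standard basis vectors attached to the ends of the edges, the common bases are the perfect
matchings. -/
lemma matroidIntersectionPolytope_single_eq {n : ℕ} (C : G.Coloring (Fin 2))
    (α : G.edgeSet → {x // C x = 0}) (β : G.edgeSet → {x // C x = 1})
    (h : ∀ e : G.edgeSet, (e : Sym2 V) = s(↑(α e), ↑(β e)))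
    (f : {x // C x = 0} ≃ Fin n) (g : {x // C x = 1} ≃ Fin n) :
    matroidIntersectionPolytope (fun e => EuclideanSpace.single (f (α e)) (1 : ℝ))
      (fun e => EuclideanSpace.single (g (β e)) (1 : ℝ)) = perfectMatchingPolytope G := by
  have hcomp : ∀ {k : Fin 2} (γ : G.edgeSet → {x // C x = k}) (f : {x // C x = k} ≃ Fin n)
      (I : Set G.edgeSet),
      Set.BijOn (fun e => f (γ e)) I Set.univ ↔ Set.BijOn γ I Set.univ := fun γ f I =>
    ⟨fun hI => ⟨Set.mapsTo_univ _ _, fun e he e' he' hee => hI.injOn he he' (congrArg f hee),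
      fun a _ => (hI.surjOn (Set.mem_univ (f a))).imp fun e he => ⟨he.1, f.injective he.2⟩⟩,
    fun hI => f.bijective.bijOn_univ.comp hI⟩
  unfold matroidIntersectionPolytope perfectMatchingPolytope
  congr 1
  ext x
  simp only [formsBasis_single_iff, hcomp α f, hcomp β g, isPerfectMatching_iff_bijOn C α β h]
  constructor
  · rintro ⟨I, hα, hβ, rfl⟩
    refine ⟨edgeSubgraph I, ?_⟩
    rw [setOf_mem_edgeSet_edgeSubgraph]
    exact ⟨⟨hα, hβ⟩, rfl⟩
  · rintro ⟨M, ⟨hα, hβ⟩, rfl⟩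
    exact ⟨_, hα, hβ, rfl⟩

/-- If `G` has a perfect matching, its color classes are equinumerous and standard basis vectors
represent its perfect matchings; otherwise zero vectors in `ℝ¹` have no common basis. -/
theorem exists_blPolytope_eq_perfectMatchingPolytope [Fintype V] [Fintype G.edgeSet]
    (hG : G.IsBipartite) :
    ∃ (n : ℕ) (v w : G.edgeSet → EuclideanSpace ℝ (Fin n)),
      blPolytope (pairDatum v w) = perfectMatchingPolytope G := by
  classical
  by_cases hM : ∃ M : G.Subgraph, M.IsPerfectMatching
  · obtain ⟨C⟩ := hG
    have hends : ∀ e : G.edgeSet, ∃ (a : {x // C x = 0}) (b : {x // C x = 1}),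
        (e : Sym2 V) = s(↑a, ↑b) := by
      rintro ⟨e, he⟩
      induction e with | _ x y
      have hxy : C x ≠ C y := C.valid he
      rcases (by omega : C x = 0 ∧ C y = 1 ∨ C x = 1 ∧ C y = 0) with ⟨hx, hy⟩ | ⟨hx, hy⟩
      · exact ⟨⟨x, hx⟩, ⟨y, hy⟩, rfl⟩
      · exact ⟨⟨y, hy⟩, ⟨x, hx⟩, Sym2.eq_swap⟩
    choose α β h using hends
    obtain ⟨M, hM⟩ := hM
    obtain ⟨hα, hβ⟩ := (isPerfectMatching_iff_bijOn C α β h M).1 hM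
    have e : {x // C x = 0} ≃ {x // C x = 1} :=
      (Equiv.Set.univ _).symm.trans ((hα.equiv α).symm.trans
        ((hβ.equiv β).trans (Equiv.Set.univ _)))
    have g := Fintype.equivFin {x // C x = 1}
    exact ⟨_, _, _, (blPolytope_pairDatum_eq_matroidIntersectionPolytope _ _).trans
      (matroidIntersectionPolytope_single_eq C α β h (e.trans g) g)⟩
  · refine ⟨1, 0, 0, (blPolytope_pairDatum_eq_matroidIntersectionPolytope _ _).trans ?_⟩
    unfold matroidIntersectionPolytope perfectMatchingPolytope
    congr 1
    ext x
    refine ⟨fun ⟨I, hI, _⟩ => ?_, fun ⟨M, hM', _⟩ => absurd ⟨M, hM'⟩ hM⟩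
    have hbot : Submodule.span ℝ ((0 : G.edgeSet → EuclideanSpace ℝ (Fin 1)) '' I) = ⊥ := by
      rw [Submodule.span_eq_bot]
      rintro _ ⟨i, _, rfl⟩
      rfl
    exact absurd (hbot.symm.trans hI.2) bot_ne_top

end PerfectMatching

theorem lemma8p1 :
    (∀ (m n : ℕ) (v w : Fin m → EuclideanSpace ℝ (Fin n)),
      blPolytope (pairDatum v w) = matroidIntersectionPolytope v w) ∧
    (∀ (V : Type*) [Fintype V] [DecidableEq V] (G : SimpleGraph V) [DecidableRel G.Adj],
      G.IsBipartite →
        ∃ (n : ℕ) (v w : G.edgeSet → EuclideanSpace ℝ (Fin n)),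
          blPolytope (pairDatum v w) = perfectMatchingPolytope G) :=
  ⟨fun _ _ v w => blPolytope_pairDatum_eq_matroidIntersectionPolytope v w,
    fun _ _ _ _ _ hG => exists_blPolytope_eq_perfectMatchingPolytope hG⟩
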